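/- Let $X$ be an irreducible normal algebraic variety over an algebraically closed field $\mathbb K$ (an integral normal separated scheme of finite type) whose divisor class group $\operatorname{Cl}(X)$ is finitely generated, possibly with torsion. For a Weil divisor $D$ put $\mathcal O(X,D)=\{f\in\mathbb K(X)\mid f=0\ \text{or}\ \operatorname{div}(f)+D\ge 0\}$. Let $S\subset\operatorname{WDiv}(X)$ be a finitely generated subgroup that maps onto $\operatorname{Cl}(X)$, let $S^0$ be the kernel of $S\to\operatorname{Cl}(X)$, and let $\mathcal F=\{F_D\in\mathbb K(X)^\times\mid D\in S^0\}$ be a family with $\operatorname{div}(F_D)=D$ and $F_{D+D'}=F_DF_{D'}$ for all $D,D'\in S^0$. Let $T_S(X)=\bigoplus_{D\in S}\mathcal O(X,D)$, with the multiplication induced by that of $\mathbb K(X)$, let $I(S,\mathcal F)\subset T_S(X)$ be the ideal that is the linear span of all elements $f-F_{D_1-D_2}f$, where $D_1,D_2\in S$, $D_1-D_2\in S^0$, $f\in\mathcal O(X,D_1)$ is placed in degree $D_1$ and $F_{D_1-D_2}f\in\mathcal O(X,D_2)$ in degree $D_2$, and let $R(X)=T_S(X)/I(S,\mathcal F)$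 be the Cox ring. For $c\in\operatorname{Cl}(X)$ let $R(X)_c$ be the image in $R(X)$ of $\bigoplus_{D\in S,\,[D]=c}\mathcal O(X,D)$. Then: 1. $R(X)=\bigoplus_{c\in\operatorname{Cl}(X)}R(X)_c$ is a $\operatorname{Cl}(X)$-graded $\mathbb K$-algebra. 2. $R(X)$ is factorially graded with respect to this grading. That is, call a non-zero non-invertible homogeneous element $a$ h-irreducible if $a=bc$ with $b,c$ homogeneous implies that $b$ or $c$ is invertible; then every non-zero non-invertible homogeneous element of $R(X)$ is a product of h-irreducible elements, and such an expression is unique up to association and renumbering. 3. For every $D\in S$ and every non-zero $f\in\mathcal O(X,D)$ the class of $f$ in $R(X)$ is a non-zero homogeneous element, and sending it to $\operatorname{div}(f)+D$ defines a bijection from the association classes of non-zero homogeneous elements of $R(X)$ (two such elements being associated if they differ by an invertible factor in $R(X)$) onto the effective Weil divisors on $X$. -/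

import Mathlib

universe u

open AlgebraicGeometry CategoryTheory

/-- An irreducible normal algebraic variety over a field `k`: an integral separated scheme of finite
type over `k` all of whose local rings are integrally closed. -/
structure NormalVariety (k : Type u) [Field k] where
  /-- the underlying scheme -/
  X : Scheme.{u}
  /-- the structure morphism -/
  hom : X ⟶ Spec (.of k)
  integral : IsIntegral X
  separated : IsSeparated hom
  locallyOfFiniteType : LocallyOfFiniteType hom
  quasiCompact : QuasiCompact hom
  normal : ∀ x : X, IsIntegrallyClosed (X.presheaf.stalk x)

namespace NormalVariety

noncomputable section

variable {k : Type u} [Field k] (V : NormalVariety k)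

instance : IsIntegral V.X := V.integral

instance : IsNoetherian V.X :=
  haveI := V.locallyOfFiniteType
  haveI := V.quasiCompact
  haveI : IsLocallyNoetherian V.X := LocallyOfFiniteType.isLocallyNoetherian V.hom
  haveI : CompactSpace V.X := QuasiCompact.compactSpace_of_compactSpace V.hom
  {}

instance : Nonempty (⊤ : V.X.Opens) := ⟨⟨genericPoint V.X, trivial⟩⟩

/-- The field `𝕂(X)` of rational functions. -/
abbrev RatFun : Type u := V.X.functionField

/-- The structure map from `k` to the ring of global regular functions. -/
def scalarMap : k →+* Γ(V.X, ⊤) :=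
  ((Scheme.ΓSpecIso (.of k)).inv ≫ V.hom.appTop).hom

instance : Algebra k V.RatFun :=
  ((V.X.germToFunctionField ⊤).hom.comp V.scalarMap).toAlgebra

/-- Prime divisors, that is integral closed subschemes of codimension one, given by their generic
points. In the order used by Mathlib `coheight` is the dimension of the local ring. -/
def PrimeDivisor : Type u := {x : V.X // Order.coheight x = 1}

instance : DecidableEq V.PrimeDivisor := Classical.decEq _

/-- The group of Weil divisors, ordered coefficientwise; a divisor `D` is effective
if `0 ≤ D`. -/
abbrev WDiv : Type u := V.PrimeDivisor →₀ ℤ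

theorem isDiscreteValuationRing_stalk (P : V.PrimeDivisor) :
    IsDiscreteValuationRing (V.X.presheaf.stalk P.1) := by
  have hd := ringKrullDim_stalk_eq_coheight P.1
  rw [P.2] at hd
  have hf : ¬ IsField (V.X.presheaf.stalk P.1) := by
    intro h
    have h0 := ringKrullDim_eq_zero_of_isField h
    rw [h0] at hd
    exact absurd hd (by decide)
  have h1 : Ring.KrullDimLE 1 (V.X.presheaf.stalk P.1) := krullDimLE_of_coheight_le P.2.le
  have hic := V.normal P.1
  have hiff : IsDiscreteValuationRing (V.X.presheaf.stalk P.1) ↔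
      IsIntegrallyClosed (V.X.presheaf.stalk P.1) ∧
        ∃! Q : Ideal (V.X.presheaf.stalk P.1), Q ≠ ⊥ ∧ Q.IsPrime :=
    (IsDiscreteValuationRing.TFAE (V.X.presheaf.stalk P.1) hf).out 0 3
  refine hiff.mpr ⟨hic, IsLocalRing.maximalIdeal (V.X.presheaf.stalk P.1),
    ⟨IsLocalRing.isField_iff_maximalIdeal_eq.not.mp hf, inferInstance⟩, ?_⟩
  rintro Q ⟨hQ0, hQ⟩
  exact IsLocalRing.eq_maximalIdeal ((Ring.krullDimLE_one_iff_of_noZeroDivisors.mp h1) Q hQ0 hQ)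

theorem finite_support_ord (f : V.RatFun) :
    (Function.support fun P : V.PrimeDivisor => V.X.ord f P.1).Finite := by
  by_cases hf : f = 0
  · subst hf
    simp
  obtain ⟨U, -, g, hU, hg, hu⟩ := exists_isUnit_germ_eq V.X f hf
  obtain ⟨T, hT, hTc, hTi, hTU⟩ :=
    TopologicalSpace.NoetherianSpace.exists_finite_set_isClosed_irreducible
      U.isOpen.isClosed_compl
  refine Set.Finite.of_finite_image (f := fun P : V.PrimeDivisor => closure {P.1})
    (hT.subset ?_) ?_
  · rintro _ ⟨P, hP, rfl⟩
    have hPU : P.1 ∈ (U : Set V.X)ᶜ := fun h => hP (by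
      have := Scheme.ord_of_isUnit hu h
      rwa [hg] at this)
    rw [hTU] at hPU
    obtain ⟨W, hW, hPW⟩ := hPU
    obtain ⟨y, hy⟩ := QuasiSober.sober (hTi W hW) (hTc W hW)
    have hyP : y ⤳ P.1 := hy.specializes hPW
    have hyU : y ∉ (U : Set V.X) := by
      have : y ∈ ⋃₀ T := ⟨W, hW, hy.mem⟩
      rwa [← hTU] at this
    suffices y = P.1 by
      simp only
      rw [← this, hy.def]
      exact hW
    by_contra hne
    have hlt : P.1 < y := lt_of_le_not_ge hyP fun h => hne (hyP.antisymm h).eq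
    have hy' : genericPoint V.X ⤳ y := genericPoint_specializes y
    have hlt' : y < genericPoint V.X := lt_of_le_not_ge hy' fun h => hyU (by
      obtain ⟨z, hz⟩ := hU
      exact h.mem_open U.isOpen ((genericPoint_specializes z).mem_open U.isOpen hz))
    have h1 := Order.coheight_add_one_le hlt
    have h2 := Order.coheight_add_one_le hlt'
    rw [P.2] at h1
    have : (1 : ℕ∞) + 1 ≤ 1 := le_trans (by gcongr; exact le_trans (by simp) h2) h1
    exact absurd this (by decide)
  · intro P _ Q _ h
    exact Subtype.ext (inseparable_iff_closure_eq.mpr h).eq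

/-- The divisor of a rational function (with the convention `div 0 = 0`). -/
def div (f : V.RatFun) : V.WDiv :=
  Finsupp.ofSupportFinite (fun P => V.X.ord f P.1) (V.finite_support_ord f)

theorem div_apply (f : V.RatFun) (P : V.PrimeDivisor) : V.div f P = V.X.ord f P.1 := rfl

theorem div_mul {f g : V.RatFun} (hf : f ≠ 0) (hg : g ≠ 0) :
    V.div (f * g) = V.div f + V.div g := by
  ext P
  simp [div_apply, Scheme.ord_mul hf hg]

theorem div_one : V.div 1 = 0 := by
  have h := V.div_mul (one_ne_zero) (one_ne_zero)
  rw [mul_one] at h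
  simpa using h

theorem div_algebraMap (c : k) : V.div (algebraMap k V.RatFun c) = 0 := by
  by_cases hc : c = 0
  · subst hc
    ext P
    simp [div_apply]
  ext P
  have hu : IsUnit (V.scalarMap c) := (IsUnit.mk0 c hc).map V.scalarMap
  have h := Scheme.ord_of_isUnit (X := V.X) (U := ⊤) (f := V.scalarMap c) hu (x := P.1) trivial
  exact h

/-- The homomorphism sending a non-zero rational function to its divisor. -/
def divHom : Additive V.RatFunˣ →+ V.WDiv where
  toFun f := V.div (f.toMul : V.RatFun)
  map_zero' := V.div_one
  map_add' f g := V.div_mul f.toMul.ne_zero g.toMul.ne_zero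

/-- The divisor class group: Weil divisors modulo principal divisors. -/
abbrev Cl : Type u := V.WDiv ⧸ V.divHom.range

/-- The projection `WDiv(X) → Cl(X)`. -/
abbrev toCl : V.WDiv →+ V.Cl := QuotientAddGroup.mk' V.divHom.range

instance : DecidableEq V.Cl := Classical.decEq _

/-- The vector space `𝒪(X, D) = {f ∈ 𝕂(X) : div(f) + D ≥ 0}`, which by convention contains `0`. -/
def sections (D : V.WDiv) : Submodule k V.RatFun where
  carrier := {f | f = 0 ∨ 0 ≤ V.div f + D}
  zero_mem' := Or.inl rfl
  add_mem' := by
    intro f g hf hg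
    by_cases hfg : f + g = 0
    · exact Or.inl hfg
    by_cases hf0 : f = 0
    · subst hf0
      simpa using hg
    by_cases hg0 : g = 0
    · subst hg0
      simpa using hf
    refine Or.inr fun P => ?_
    have := V.isDiscreteValuationRing_stalk P
    have h := Scheme.ord_add (x := P.1) hfg
    have h1 := (hf.resolve_left hf0) P
    have h2 := (hg.resolve_left hg0) P
    simp only [Finsupp.coe_zero, Pi.zero_apply, Finsupp.coe_add, Pi.add_apply, div_apply]
      at h1 h2 ⊢
    omega
  smul_mem' := by
    intro c f hf
    by_cases h0 : c • f = 0
    · exact Or.inl h0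
    have hc : algebraMap k V.RatFun c ≠ 0 := fun h => h0 (by rw [Algebra.smul_def, h, zero_mul])
    have hf0 : f ≠ 0 := fun h => h0 (by rw [h, smul_zero])
    refine Or.inr ?_
    rw [Algebra.smul_def, V.div_mul hc hf0, V.div_algebraMap, zero_add]
    exact hf.resolve_left hf0

theorem mem_sections {D : V.WDiv} {f : V.RatFun} :
    f ∈ V.sections D ↔ f = 0 ∨ 0 ≤ V.div f + D := Iff.rfl

variable (S : AddSubgroup V.WDiv)

instance : SetLike.GradedMonoid fun D : S => V.sections D where
  one_mem := Or.inr (by simp [div_one])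
  mul_mem := by
    intro D E f g hf hg
    by_cases hfg : f * g = 0
    · exact Or.inl hfg
    have hf0 := left_ne_zero_of_mul hfg
    have hg0 := right_ne_zero_of_mul hfg
    refine Or.inr ?_
    rw [V.div_mul hf0 hg0, AddSubgroup.coe_add, add_add_add_comm]
    exact add_nonneg (hf.resolve_left hf0) (hg.resolve_left hg0)

/-- The `S`-graded ring `T_S(X) = ⨁_{D ∈ S} 𝒪(X, D)`, with the multiplication of `𝕂(X)` on
homogeneous elements. -/
abbrev T : Type u := DirectSum S fun D => V.sections (D : V.WDiv)

instance : CommRing (V.T S) := DirectSum.commRing (fun D : S => V.sections (D : V.WDiv))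

instance : Algebra k (V.T S) := inferInstance

/-- The kernel `S⁰` of the projection `S → Cl(X)`. -/
def S0 : AddSubgroup S := (V.toCl.comp S.subtype).ker

/-- A coherent family of rational functions `F_D ∈ 𝕂(X)^×`, `D ∈ S⁰`. -/
structure CoherentFamily where
  /-- the rational function `F_D` -/
  F : V.S0 S → V.RatFunˣ
  div_F : ∀ D : V.S0 S, V.div (F D : V.RatFun) = ((D : S) : V.WDiv)
  F_add : ∀ D E : V.S0 S, F (D + E) = F D * F E

variable {V S} (𝓕 : V.CoherentFamily S)

namespace CoherentFamily

theorem mul_mem {D E : S} (h : D - E ∈ V.S0 S) (f : V.sections (D : V.WDiv)) :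
    (𝓕.F ⟨D - E, h⟩ : V.RatFun) * (f : V.RatFun) ∈ V.sections (E : V.WDiv) := by
  obtain ⟨f, hf⟩ := f
  by_cases hf0 : f = 0
  · exact Or.inl (by simp [hf0])
  refine Or.inr ?_
  rw [V.div_mul (Units.ne_zero _) hf0, 𝓕.div_F]
  have := hf.resolve_left hf0
  simp only [AddSubgroup.coe_sub]
  convert this using 1
  abel

/-- The element `F_{D-E} f` of `𝒪(X, E)`, for `f ∈ 𝒪(X, D)` and `D - E ∈ S⁰`. -/
def shift {D E : S} (h : D - E ∈ V.S0 S) (f : V.sections (D : V.WDiv)) :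
    V.sections (E : V.WDiv) :=
  ⟨(𝓕.F ⟨D - E, h⟩ : V.RatFun) * (f : V.RatFun), 𝓕.mul_mem h f⟩

/-- The elements `f - F_{D-E} f` of `T_S(X)`, for all `D - E ∈ S⁰` and `f ∈ 𝒪(X, D)`, where `f` is
placed in degree `D` and `F_{D-E} f` in degree `E`. -/
def relations : Set (V.T S) :=
  {t | ∃ (D E : S) (h : D - E ∈ V.S0 S) (f : V.sections (D : V.WDiv)),
    t = DirectSum.of (fun D : S => V.sections (D : V.WDiv)) D f -
      DirectSum.of (fun D : S => V.sections (D : V.WDiv)) E (𝓕.shift h f)}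

theorem of_mul_relations {G : S} (g : V.sections (G : V.WDiv)) {t : V.T S}
    (ht : t ∈ 𝓕.relations) :
    DirectSum.of (fun D : S => V.sections (D : V.WDiv)) G g * t ∈ 𝓕.relations := by
  obtain ⟨D, E, h, f, rfl⟩ := ht
  have e : (G + D) - (G + E) = D - E := by abel
  refine ⟨G + D, G + E, e ▸ h,
    ⟨(g : V.RatFun) * (f : V.RatFun),
      SetLike.GradedMul.mul_mem (A := fun D : S => V.sections (D : V.WDiv)) g.2 f.2⟩, ?_⟩
  rw [mul_sub, DirectSum.of_mul_of, DirectSum.of_mul_of]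
  congr 2
  apply Subtype.ext
  change (g : V.RatFun) * (_ * (f : V.RatFun)) = _ * ((g : V.RatFun) * (f : V.RatFun))
  simp only [e]
  ring

/-- The ideal `I(S, 𝓕)`: the linear span of the elements `f - F_{D-E} f`. -/
def I : Ideal (V.T S) where
  __ := Submodule.span k 𝓕.relations
  smul_mem' := by
    intro r t ht
    change r * t ∈ Submodule.span k 𝓕.relations
    replace ht : t ∈ Submodule.span k 𝓕.relations := ht
    induction r using DirectSum.induction_on with
    | zero => simp
    | add x y hx hy => rw [add_mul]; exact add_mem hx hy
    | of G g =>
      induction ht using Submodule.span_induction with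
      | mem t ht => exact Submodule.subset_span (𝓕.of_mul_relations g ht)
      | zero => simp
      | add x y _ _ hx hy => rw [mul_add]; exact add_mem hx hy
      | smul c x _ hx => rw [mul_smul_comm]; exact Submodule.smul_mem _ _ hx

/-- The Cox ring `R_{S,𝓕}(X) = T_S(X) / I(S, 𝓕)`. -/
abbrev CoxRing : Type u := V.T S ⧸ 𝓕.I

/-- The class in the Cox ring of `f ∈ 𝒪(X, D)`, placed in degree `D ∈ S`. -/
def cls (D : S) : V.sections (D : V.WDiv) →ₗ[k] 𝓕.CoxRing :=
  (Ideal.Quotient.mkₐ k 𝓕.I).toLinearMap ∘ₗ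
    DirectSum.lof k S (fun D => V.sections (D : V.WDiv)) D

/-- The homogeneous component of degree `c ∈ Cl(X)` of the Cox ring: the image of
`⨁_{D ∈ S, [D] = c} 𝒪(X, D)`. -/
def grading (c : V.Cl) : Submodule k 𝓕.CoxRing :=
  ⨆ D : {D : S // V.toCl (D : V.WDiv) = c}, LinearMap.range (𝓕.cls D.1)

end CoherentFamily

end

end NormalVariety

/-! Graded factoriality of a graded algebra. -/

section Graded

variable {ι k R : Type*} [CommSemiring k] [CommRing R] [Algebra k R] (𝒜 : ι → Submodule k R)

/-- A non-zero non-invertible homogeneous element `a` is h-irreducible if in every factorization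
`a = b c` into homogeneous elements one of the factors is invertible. -/
def IsHIrreducible (a : R) : Prop :=
  SetLike.IsHomogeneousElem 𝒜 a ∧ a ≠ 0 ∧ ¬ IsUnit a ∧
    ∀ b c : R, SetLike.IsHomogeneousElem 𝒜 b → SetLike.IsHomogeneousElem 𝒜 c → a = b * c →
      IsUnit b ∨ IsUnit c

/-- Every non-zero non-invertible homogeneous element is a product of h-irreducible elements, and
the factors are unique up to association and renumbering. -/
def IsFactoriallyGraded : Prop :=
  ∀ a : R, SetLike.IsHomogeneousElem 𝒜 a → a ≠ 0 → ¬ IsUnit a →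
    (∃ s : Multiset R, (∀ p ∈ s, IsHIrreducible 𝒜 p) ∧ s.prod = a) ∧
    ∀ s t : Multiset R, (∀ p ∈ s, IsHIrreducible 𝒜 p) → (∀ p ∈ t, IsHIrreducible 𝒜 p) →
      s.prod = a → t.prod = a → Multiset.Rel Associated s t

/-- The non-zero homogeneous elements. -/
def NonzeroHomogeneous : Type _ := {a : R // SetLike.IsHomogeneousElem 𝒜 a ∧ a ≠ 0}

/-- Association of non-zero homogeneous elements: they differ by an invertible factor of `R`. -/
instance associationSetoid : Setoid (NonzeroHomogeneous 𝒜) :=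
  (Associated.setoid R).comap Subtype.val

/-- The association classes of non-zero homogeneous elements. -/
def AssociationClass : Type _ := Quotient (associationSetoid 𝒜)

end Graded

namespace NormalVariety

noncomputable section

variable {k : Type u} [Field k] {V : NormalVariety k} {S : AddSubgroup V.WDiv}

/-! To a non-zero homogeneous element of `R(X)`, the class of some `f ∈ 𝒪(X, D)`, attach the
effective divisor `div f + D`. Replacing `f` by `F_{D-E} f` in degree `E` leaves this divisor
unchanged, so it should depend only on the class. Well-definedness needs the ideal not to identify
too much. After choosing a representative in `S` of each divisor class, multiplication by the
functions of `𝓕` moves all sections of a class into a single copy of `𝕂(X)`; this linear map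
(`separation`) kills the ideal and is injective on each component, which also makes the sum of the
components direct.

The divisor is additive on products. Divisibility of homogeneous elements is the order on divisors
(`HasDivisor.exists_mul_eq`, `HasDivisor.le_of_mul_eq`), and every effective divisor occurs because
`S` maps onto `Cl(X)` (`exists_hasDivisor`). Hence non-zero homogeneous elements up to association
form the free commutative monoid on the prime divisors: h-irreducible elements are those whose
divisor is prime, and unique factorization is that of effective divisors. -/

theorem div_inv {f : V.RatFun} (hf : f ≠ 0) : V.div f⁻¹ = -V.div f := by
  have h := V.div_mul hf (inv_ne_zero hf)
  rw [mul_inv_cancel₀ hf, V.div_one] at h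
  exact (neg_eq_of_add_eq_zero_right h.symm).symm

theorem sub_mem_S0_iff {D E : S} :
    D - E ∈ V.S0 S ↔ V.toCl (D : V.WDiv) = V.toCl (E : V.WDiv) := by
  rw [S0, AddMonoidHom.mem_ker, map_sub, sub_eq_zero]
  rfl

theorem sum_map_single_apply (m : Multiset V.PrimeDivisor) (P : V.PrimeDivisor) :
    (m.map fun P => Finsupp.single P (1 : ℤ)).sum P = m.count P := by
  induction m using Multiset.induction with
  | empty => rfl
  | cons Q m ih =>
    rw [Multiset.map_cons, Multiset.sum_cons, Finsupp.add_apply, ih, Multiset.count_cons,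
      Finsupp.single_apply, Nat.cast_add, Nat.cast_ite, Nat.cast_one, Nat.cast_zero, add_comm]
    simp only [eq_comm]

theorem exists_multiset_sum_eq {E : V.WDiv} (hE : 0 ≤ E) :
    ∃ m : Multiset V.PrimeDivisor, (m.map fun P => Finsupp.single P (1 : ℤ)).sum = E := by
  refine ⟨Finsupp.toMultiset (E.mapRange Int.toNat rfl), ?_⟩
  ext P
  rw [sum_map_single_apply, Finsupp.count_toMultiset, Finsupp.mapRange_apply,
    Int.toNat_of_nonneg (hE P)]

/-! ### Classes of sections and the components of the Cox ring -/

namespace CoherentFamily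

variable (𝓕 : V.CoherentFamily S)

theorem cls_apply (D : S) (f : V.sections (D : V.WDiv)) :
    𝓕.cls D f =
      Ideal.Quotient.mk 𝓕.I (DirectSum.of (fun D : S => V.sections (D : V.WDiv)) D f) := rfl

theorem cls_shift {D E : S} (h : D - E ∈ V.S0 S) (f : V.sections (D : V.WDiv)) :
    𝓕.cls E (𝓕.shift h f) = 𝓕.cls D f := by
  rw [cls_apply, cls_apply, eq_comm, Ideal.Quotient.mk_eq_mk_iff_sub_mem]
  exact Submodule.subset_span (s := 𝓕.relations) (R := k) ⟨D, E, h, f, rfl⟩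

theorem cls_mul_cls {D E : S} (f : V.sections (D : V.WDiv)) (g : V.sections (E : V.WDiv)) :
    𝓕.cls D f * 𝓕.cls E g =
      𝓕.cls (D + E) ⟨(f : V.RatFun) * (g : V.RatFun),
        SetLike.GradedMul.mul_mem (A := fun D : S => V.sections (D : V.WDiv)) f.2 g.2⟩ := by
  rw [cls_apply, cls_apply, ← map_mul, DirectSum.of_mul_of]
  rfl

theorem cls_zero_one :
    𝓕.cls 0 ⟨1, SetLike.GradedOne.one_mem (A := fun D : S => V.sections (D : V.WDiv))⟩ = 1 := rfl

theorem cls_congr {D E : S} (h : D = E) {f : V.sections (D : V.WDiv)}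
    {g : V.sections (E : V.WDiv)} (hfg : (f : V.RatFun) = g) : 𝓕.cls D f = 𝓕.cls E g := by
  subst h
  rw [Subtype.ext hfg]

theorem range_cls_le {D E : S} (h : V.toCl (D : V.WDiv) = V.toCl (E : V.WDiv)) :
    LinearMap.range (𝓕.cls D) ≤ LinearMap.range (𝓕.cls E) := by
  rintro _ ⟨f, rfl⟩
  exact ⟨𝓕.shift (sub_mem_S0_iff.mpr h) f, 𝓕.cls_shift _ f⟩

/-- Shifting by `𝓕` carries sections of any divisor in the class to sections of `D` with the same
image, so the supremum collapses to one term. -/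
theorem grading_eq_range_cls (D : S) :
    𝓕.grading (V.toCl (D : V.WDiv)) = LinearMap.range (𝓕.cls D) :=
  le_antisymm (iSup_le fun E => 𝓕.range_cls_le E.2)
    (le_iSup (fun E : {E : S // V.toCl (E : V.WDiv) = V.toCl (D : V.WDiv)} =>
      LinearMap.range (𝓕.cls E.1)) ⟨D, rfl⟩)

theorem cls_mem_grading (D : S) (f : V.sections (D : V.WDiv)) :
    𝓕.cls D f ∈ 𝓕.grading (V.toCl (D : V.WDiv)) := by
  rw [grading_eq_range_cls]
  exact ⟨f, rfl⟩

theorem iSup_grading : ⨆ c, 𝓕.grading c = ⊤ := by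
  rw [eq_top_iff]
  rintro a -
  obtain ⟨t, rfl⟩ := Ideal.Quotient.mk_surjective a
  induction t using DirectSum.induction_on with
  | zero => rw [map_zero]; exact zero_mem _
  | add x y hx hy => rw [map_add]; exact add_mem hx hy
  | of D f => exact Submodule.mem_iSup_of_mem _ (𝓕.cls_mem_grading D f)

/-! ### Separating the components, and the grading by the class group -/

section Separation

variable {rep : V.Cl → S} (hrep : ∀ c, V.toCl (rep c : V.WDiv) = c)

/-- The linear map `⨁_{D ∈ S} 𝒪(X, D) → ⨁_{c ∈ Cl(X)} 𝕂(X)` that uses the family `𝓕` to move `f` to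
the chosen representative `rep c` of its class `c`. -/
def preSeparation : V.T S →ₗ[k] (V.Cl →₀ V.RatFun) :=
  DirectSum.toModule k S _ fun D =>
    Finsupp.lsingle (V.toCl (D : V.WDiv)) ∘ₗ
      LinearMap.mulLeft k
        (𝓕.F ⟨D - rep (V.toCl (D : V.WDiv)), sub_mem_S0_iff.mpr (hrep _).symm⟩ : V.RatFun) ∘ₗ
      (V.sections (D : V.WDiv)).subtype

theorem preSeparation_of (D : S) (f : V.sections (D : V.WDiv)) :
    𝓕.preSeparation hrep (DirectSum.of (fun D : S => V.sections (D : V.WDiv)) D f) =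
      Finsupp.single (V.toCl (D : V.WDiv))
        ((𝓕.F ⟨D - rep (V.toCl (D : V.WDiv)), sub_mem_S0_iff.mpr (hrep _).symm⟩ : V.RatFun) *
          (f : V.RatFun)) := by
  rw [preSeparation, ← DirectSum.lof_eq_of k, DirectSum.toModule_lof]
  rfl

theorem restrictScalars_I_le_ker_preSeparation :
    𝓕.I.restrictScalars k ≤ LinearMap.ker (𝓕.preSeparation hrep) := by
  change Submodule.span k 𝓕.relations ≤ _
  rw [Submodule.span_le]
  rintro _ ⟨D, E, h, f, rfl⟩
  have hDE := sub_mem_S0_iff.mp h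
  -- Multiplicativity of `𝓕`: shifting from `D` to `rep c` directly or by way of `E` gives the same
  -- function, so both terms of a relation have the same image.
  have key : ∀ c, (hD : D - rep c ∈ V.S0 S) → (hE : E - rep c ∈ V.S0 S) →
      𝓕.F ⟨D - rep c, hD⟩ = 𝓕.F ⟨E - rep c, hE⟩ * 𝓕.F ⟨D - E, h⟩ := by
    intro c hD hE
    rw [← 𝓕.F_add]
    congr 1
    exact Subtype.ext (by simp)
  rw [SetLike.mem_coe, LinearMap.mem_ker, map_sub, preSeparation_of, preSeparation_of, sub_eq_zero]
  simp only [← hDE]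
  rw [key _ _ (sub_mem_S0_iff.mpr (by rw [hrep, hDE]))]
  simp only [Units.val_mul, shift, mul_assoc]

/-- The linear map from the Cox ring to `⨁_{c ∈ Cl(X)} 𝕂(X)` induced by `preSeparation`. -/
def separation : 𝓕.CoxRing →ₗ[k] (V.Cl →₀ V.RatFun) :=
  (𝓕.I.restrictScalars k).liftQ (𝓕.preSeparation hrep)
    (𝓕.restrictScalars_I_le_ker_preSeparation hrep) ∘ₗ
  (Submodule.Quotient.restrictScalarsEquiv k 𝓕.I).symm.toLinearMap

theorem separation_cls {D : S} {c : V.Cl} (hc : V.toCl (D : V.WDiv) = c)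
    (f : V.sections (D : V.WDiv)) :
    𝓕.separation hrep (𝓕.cls D f) =
      Finsupp.single c
        ((𝓕.F ⟨D - rep c, sub_mem_S0_iff.mpr (hc.trans (hrep c).symm)⟩ : V.RatFun) *
          (f : V.RatFun)) := by
  subst hc
  exact 𝓕.preSeparation_of hrep D f

include hrep

/-- On `𝒪(X, D)`, `separation` is multiplication by a non-zero rational function, hence injective.
-/
theorem cls_eq_zero_iff (D : S) (f : V.sections (D : V.WDiv)) : 𝓕.cls D f = 0 ↔ f = 0 := by
  refine ⟨fun h => ?_, fun h => by rw [h, map_zero]⟩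
  have h' := 𝓕.separation_cls hrep rfl f
  rw [h, map_zero, eq_comm, Finsupp.single_eq_zero] at h'
  exact Subtype.ext ((mul_eq_zero.mp h').resolve_left (Units.ne_zero _))

/-- Two homogeneous sections with the same non-zero class in the Cox ring have the same divisor. -/
theorem div_add_eq_of_cls_eq {D E : S} {f : V.sections (D : V.WDiv)}
    {g : V.sections (E : V.WDiv)} (hf : f ≠ 0) (h : 𝓕.cls D f = 𝓕.cls E g) :
    V.div (f : V.RatFun) + (D : V.WDiv) = V.div (g : V.RatFun) + (E : V.WDiv) := by
  have hg : g ≠ 0 := fun hg => hf ((𝓕.cls_eq_zero_iff hrep D f).mp (by rw [h, hg, map_zero]))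
  have hf' : (f : V.RatFun) ≠ 0 := fun h => hf (Subtype.ext h)
  have hg' : (g : V.RatFun) ≠ 0 := fun h => hg (Subtype.ext h)
  have h' := congrArg (𝓕.separation hrep) h
  rw [𝓕.separation_cls hrep rfl, 𝓕.separation_cls hrep rfl,
    Finsupp.single_eq_single_iff] at h'
  obtain ⟨hDE, h'⟩ := h'.resolve_right
    fun h => mul_ne_zero (Units.ne_zero _) hf' h.1
  -- Since `div F_{D - rep c} = D - rep c`, both sides are the wanted divisors minus the common
  -- representative.
  have h2 := congrArg V.div h'
  rw [V.div_mul (Units.ne_zero _) hf', V.div_mul (Units.ne_zero _) hg', 𝓕.div_F, 𝓕.div_F,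
    AddSubgroup.coe_sub, AddSubgroup.coe_sub, hDE, sub_add_eq_add_sub, sub_add_eq_add_sub] at h2
  rw [add_comm, sub_left_injective h2, add_comm]

theorem mem_grading_iff {c : V.Cl} {a : 𝓕.CoxRing} :
    a ∈ 𝓕.grading c ↔ ∃ f, 𝓕.cls (rep c) f = a := by
  have h := 𝓕.grading_eq_range_cls (rep c)
  rw [hrep] at h
  rw [h, LinearMap.mem_range]

theorem gradedMonoid_grading : SetLike.GradedMonoid 𝓕.grading where
  one_mem := 𝓕.cls_mem_grading 0 _
  mul_mem := by
    intro c d a b ha hb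
    obtain ⟨f, rfl⟩ := (𝓕.mem_grading_iff hrep).mp ha
    obtain ⟨g, rfl⟩ := (𝓕.mem_grading_iff hrep).mp hb
    rw [cls_mul_cls]
    convert 𝓕.cls_mem_grading _ _ using 2
    rw [AddSubgroup.coe_add, map_add, hrep, hrep]

theorem separation_apply_eq_zero {c d : V.Cl} (hcd : c ≠ d) {a : 𝓕.CoxRing}
    (ha : a ∈ 𝓕.grading c) : 𝓕.separation hrep a d = 0 := by
  obtain ⟨f, rfl⟩ := (𝓕.mem_grading_iff hrep).mp ha
  rw [𝓕.separation_cls hrep (hrep c), Finsupp.single_eq_of_ne hcd.symm]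

theorem eq_zero_of_separation_apply_eq_zero {c : V.Cl} {a : 𝓕.CoxRing}
    (ha : a ∈ 𝓕.grading c) (h : 𝓕.separation hrep a c = 0) : a = 0 := by
  obtain ⟨f, rfl⟩ := (𝓕.mem_grading_iff hrep).mp ha
  rw [cls_eq_zero_iff _ hrep]
  rw [𝓕.separation_cls hrep (hrep c), Finsupp.single_eq_same] at h
  exact Subtype.ext ((mul_eq_zero.mp h).resolve_left (Units.ne_zero _))

/-- The `c`-coordinate of `separation` vanishes on every other component and is injective on that of
degree `c`. -/
theorem isInternal_grading : DirectSum.IsInternal 𝓕.grading := by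
  refine DirectSum.isInternal_submodule_of_iSupIndep_of_iSup_eq_top ?_ 𝓕.iSup_grading
  rw [iSupIndep_def]
  intro c
  rw [Submodule.disjoint_def]
  intro a ha ha'
  refine 𝓕.eq_zero_of_separation_apply_eq_zero hrep ha ?_
  have hle : ⨆ d, ⨆ (_ : d ≠ c), 𝓕.grading d ≤
      LinearMap.ker (Finsupp.lapply (R := k) c ∘ₗ 𝓕.separation hrep) :=
    iSup₂_le fun d hd b hb => 𝓕.separation_apply_eq_zero hrep hd hb
  exact hle ha'

/-- The Cox ring is graded by the class group. -/
@[reducible]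
def gradedAlgebra : GradedAlgebra 𝓕.grading :=
  { 𝓕.gradedMonoid_grading hrep, (𝓕.isInternal_grading hrep).chooseDecomposition with }

end Separation

/-- `a` is the class of a non-zero section `f ∈ 𝒪(X, D)` with `div f + D = E`. -/
def HasDivisor (a : 𝓕.CoxRing) (E : V.WDiv) : Prop :=
  ∃ (D : S) (f : V.sections (D : V.WDiv)), f ≠ 0 ∧ 𝓕.cls D f = a ∧
    V.div (f : V.RatFun) + (D : V.WDiv) = E

/-! ### Divisibility, units and association in terms of divisors -/

namespace HasDivisor

variable {𝓕}

theorem of_cls {D : S} {f : V.sections (D : V.WDiv)} (hf : f ≠ 0) :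
    𝓕.HasDivisor (𝓕.cls D f) (V.div (f : V.RatFun) + (D : V.WDiv)) := ⟨D, f, hf, rfl, rfl⟩

theorem nonneg {a : 𝓕.CoxRing} {E : V.WDiv} (h : 𝓕.HasDivisor a E) : 0 ≤ E := by
  obtain ⟨D, f, hf, -, rfl⟩ := h
  exact f.2.resolve_left fun h => hf (Subtype.ext h)

theorem isHomogeneousElem {a : 𝓕.CoxRing} {E : V.WDiv} (h : 𝓕.HasDivisor a E) :
    SetLike.IsHomogeneousElem 𝓕.grading a := by
  obtain ⟨D, f, -, rfl, -⟩ := h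
  exact ⟨_, 𝓕.cls_mem_grading D f⟩

theorem one : 𝓕.HasDivisor 1 0 :=
  ⟨0, _, fun h => one_ne_zero (congrArg Subtype.val h), 𝓕.cls_zero_one, by simp [V.div_one]⟩

theorem mul {a b : 𝓕.CoxRing} {E E' : V.WDiv} (ha : 𝓕.HasDivisor a E) (hb : 𝓕.HasDivisor b E') :
    𝓕.HasDivisor (a * b) (E + E') := by
  obtain ⟨D, f, hf, rfl, rfl⟩ := ha
  obtain ⟨D', g, hg, rfl, rfl⟩ := hb
  have hf' : (f : V.RatFun) ≠ 0 := fun h => hf (Subtype.ext h)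
  have hg' : (g : V.RatFun) ≠ 0 := fun h => hg (Subtype.ext h)
  refine ⟨D + D', _, fun h => mul_ne_zero hf' hg' (congrArg Subtype.val h),
    (𝓕.cls_mul_cls f g).symm, ?_⟩
  rw [V.div_mul hf' hg', AddSubgroup.coe_add, add_add_add_comm]

/-- Divisibility in the Cox ring can be read off from the divisors. -/
theorem exists_mul_eq {a b : 𝓕.CoxRing} {E E' : V.WDiv} (ha : 𝓕.HasDivisor a E)
    (hb : 𝓕.HasDivisor b E') (h : E ≤ E') :
    ∃ c, 𝓕.HasDivisor c (E' - E) ∧ a * c = b := by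
  obtain ⟨D, f, hf, rfl, rfl⟩ := ha
  obtain ⟨D', g, hg, rfl, rfl⟩ := hb
  have hf' : (f : V.RatFun) ≠ 0 := fun h => hf (Subtype.ext h)
  have hg' : (g : V.RatFun) ≠ 0 := fun h => hg (Subtype.ext h)
  have e : V.div ((g : V.RatFun) * (f : V.RatFun)⁻¹) + ((D' - D : S) : V.WDiv) =
      V.div (g : V.RatFun) + (D' : V.WDiv) - (V.div (f : V.RatFun) + (D : V.WDiv)) := by
    rw [V.div_mul hg' (inv_ne_zero hf'), V.div_inv hf', AddSubgroup.coe_sub]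
    abel
  -- The cofactor is the quotient `g / f` in degree `D' - D`; that it is a section there is exactly
  -- the assumption `E ≤ E'`.
  refine ⟨𝓕.cls (D' - D) ⟨(g : V.RatFun) * (f : V.RatFun)⁻¹,
    Or.inr (e ▸ sub_nonneg.mpr h)⟩, ⟨_, _, ?_, rfl, e⟩, ?_⟩
  · exact fun h => mul_ne_zero hg' (inv_ne_zero hf') (congrArg Subtype.val h)
  · rw [cls_mul_cls]
    exact 𝓕.cls_congr (add_sub_cancel D D') (mul_div_cancel₀ _ hf')

theorem isUnit {a : 𝓕.CoxRing} (h : 𝓕.HasDivisor a 0) : IsUnit a := by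
  obtain ⟨c, -, hc⟩ := h.exists_mul_eq one le_rfl
  exact IsUnit.of_mul_eq_one c hc

theorem associated {a b : 𝓕.CoxRing} {E : V.WDiv} (ha : 𝓕.HasDivisor a E)
    (hb : 𝓕.HasDivisor b E) : Associated a b := by
  obtain ⟨c, hc, hab⟩ := ha.exists_mul_eq hb le_rfl
  rw [sub_self] at hc
  exact ⟨hc.isUnit.unit, hab⟩

variable {rep : V.Cl → S} (hrep : ∀ c, V.toCl (rep c : V.WDiv) = c)
include hrep

theorem unique {a : 𝓕.CoxRing} {E E' : V.WDiv} (h : 𝓕.HasDivisor a E)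
    (h' : 𝓕.HasDivisor a E') : E = E' := by
  obtain ⟨D, f, hf, rfl, rfl⟩ := h
  obtain ⟨D', g, -, hg, rfl⟩ := h'
  exact 𝓕.div_add_eq_of_cls_eq hrep hf hg.symm

theorem ne_zero {a : 𝓕.CoxRing} {E : V.WDiv} (h : 𝓕.HasDivisor a E) : a ≠ 0 := by
  obtain ⟨D, f, hf, rfl, -⟩ := h
  exact (𝓕.cls_eq_zero_iff hrep D f).not.mpr hf

/-- The cofactor `u` need not be homogeneous, but only its component of degree `deg b - deg a`
contributes to `b`. This lets units and association in the whole ring be tested on divisors. -/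
theorem le_of_mul_eq {a b u : 𝓕.CoxRing} {E E' : V.WDiv} (ha : 𝓕.HasDivisor a E)
    (hb : 𝓕.HasDivisor b E') (h : a * u = b) : E ≤ E' := by
  let _ := 𝓕.gradedAlgebra hrep
  obtain ⟨c, hc⟩ := ha.isHomogeneousElem
  obtain ⟨d, hd⟩ := hb.isHomogeneousElem
  have h1 := DirectSum.coe_decompose_mul_add_of_left_mem 𝓕.grading (j := d - c) (b := u) hc
  rw [h, add_sub_cancel, DirectSum.decompose_of_mem_same _ hd] at h1
  obtain ⟨f, hf⟩ := (𝓕.mem_grading_iff hrep).mp (DirectSum.decompose 𝓕.grading u (d - c)).2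
  rw [← hf] at h1
  have hf0 : f ≠ 0 := fun h0 => hb.ne_zero hrep (by rw [h1, h0, map_zero, mul_zero])
  have h2 := ha.mul (of_cls (𝓕 := 𝓕) hf0)
  rw [← h1] at h2
  rw [hb.unique hrep h2]
  exact le_add_of_nonneg_right (of_cls (𝓕 := 𝓕) hf0).nonneg

theorem isUnit_iff {a : 𝓕.CoxRing} {E : V.WDiv} (h : 𝓕.HasDivisor a E) : IsUnit a ↔ E = 0 := by
  refine ⟨fun ha => ?_, fun hE => (hE ▸ h).isUnit⟩
  obtain ⟨u, hu⟩ := ha.exists_right_inv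
  exact le_antisymm (h.le_of_mul_eq hrep one hu) h.nonneg

theorem associated_iff {a b : 𝓕.CoxRing} {E E' : V.WDiv} (ha : 𝓕.HasDivisor a E)
    (hb : 𝓕.HasDivisor b E') : Associated a b ↔ E = E' := by
  refine ⟨fun h => ?_, fun h => ha.associated (h ▸ hb)⟩
  obtain ⟨u, hu⟩ := h
  obtain ⟨v, hv⟩ := Associated.symm ⟨u, hu⟩
  exact le_antisymm (ha.le_of_mul_eq hrep hb hu) (hb.le_of_mul_eq hrep ha hv)

end HasDivisor

/-- The divisor of a homogeneous element of the Cox ring; elements without a divisor get `0`. -/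
def divisor (a : 𝓕.CoxRing) : V.WDiv :=
  open Classical in if h : ∃ E, 𝓕.HasDivisor a E then h.choose else 0

/-! ### Prime divisors as h-irreducible elements, and unique factorization -/

section Factoriality

variable {rep : V.Cl → S} (hrep : ∀ c, V.toCl (rep c : V.WDiv) = c)
include hrep

theorem exists_hasDivisor_of_isHomogeneousElem {a : 𝓕.CoxRing}
    (ha : SetLike.IsHomogeneousElem 𝓕.grading a) (h0 : a ≠ 0) : ∃ E, 𝓕.HasDivisor a E := by
  obtain ⟨c, hc⟩ := ha
  obtain ⟨f, rfl⟩ := (𝓕.mem_grading_iff hrep).mp hc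
  exact ⟨_, HasDivisor.of_cls fun h => h0 (by rw [h, map_zero])⟩

/-- `E` differs from the representative of its class by a principal divisor `div f`, and `f` is the
required section. -/
theorem exists_hasDivisor {E : V.WDiv} (hE : 0 ≤ E) : ∃ a, 𝓕.HasDivisor a E := by
  have h : V.toCl (rep (V.toCl E) : V.WDiv) = V.toCl E := hrep _
  rw [QuotientAddGroup.mk'_apply, QuotientAddGroup.mk'_apply, QuotientAddGroup.eq] at h
  obtain ⟨f, hf⟩ := h
  have hf' : V.div (f.toMul : V.RatFun) + (rep (V.toCl E) : V.WDiv) = E := by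
    change V.divHom f + _ = E
    rw [hf]
    exact neg_add_cancel_comm _ _
  exact ⟨_, rep (V.toCl E), ⟨(f.toMul : V.RatFun), Or.inr (hf'.symm ▸ hE)⟩,
    fun h => f.toMul.ne_zero (congrArg Subtype.val h), rfl, hf'⟩

theorem isHIrreducible_of_hasDivisor_single {a : 𝓕.CoxRing} {P : V.PrimeDivisor}
    (h : 𝓕.HasDivisor a (Finsupp.single P 1)) : IsHIrreducible 𝓕.grading a := by
  refine ⟨h.isHomogeneousElem, h.ne_zero hrep, ?_, ?_⟩
  · rw [h.isUnit_iff hrep]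
    simp
  · rintro b c hb hc rfl
    obtain ⟨E, hE⟩ := 𝓕.exists_hasDivisor_of_isHomogeneousElem hrep hb
      (left_ne_zero_of_mul (h.ne_zero hrep))
    obtain ⟨E', hE'⟩ := 𝓕.exists_hasDivisor_of_isHomogeneousElem hrep hc
      (right_ne_zero_of_mul (h.ne_zero hrep))
    rw [hE.isUnit_iff hrep, hE'.isUnit_iff hrep]
    have hsum := h.unique hrep (hE.mul hE')
    have hnn := hE.nonneg
    have hnn' := hE'.nonneg
    -- Two effective divisors with sum `P` vanish away from `P`, and at `P` the coefficient 1 leaves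
    -- one of them zero.
    have hQ : ∀ Q, Q ≠ P → E Q = 0 ∧ E' Q = 0 := by
      intro Q hQ
      have h1 := DFunLike.congr_fun hsum Q
      have h2 := hnn Q
      have h3 := hnn' Q
      rw [Finsupp.single_eq_of_ne hQ, Finsupp.add_apply] at h1
      simp only [Finsupp.coe_zero, Pi.zero_apply] at h2 h3
      omega
    have h1 := DFunLike.congr_fun hsum P
    have h2 := hnn P
    have h3 := hnn' P
    rw [Finsupp.single_eq_same, Finsupp.add_apply] at h1
    simp only [Finsupp.coe_zero, Pi.zero_apply] at h2 h3
    have h4 : E P = 0 ∨ E' P = 0 := by omega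
    refine h4.imp (fun h4 => ?_) (fun h4 => ?_) <;> ext Q <;> by_cases hQP : Q = P
    · rw [hQP, h4]; rfl
    · exact (hQ Q hQP).1
    · rw [hQP, h4]; rfl
    · exact (hQ Q hQP).2

theorem exists_hasDivisor_single_of_isHIrreducible {a : 𝓕.CoxRing}
    (h : IsHIrreducible 𝓕.grading a) : ∃ P, 𝓕.HasDivisor a (Finsupp.single P 1) := by
  obtain ⟨hh, h0, hu, hirr⟩ := h
  obtain ⟨E, hE⟩ := 𝓕.exists_hasDivisor_of_isHomogeneousElem hrep hh h0
  rw [hE.isUnit_iff hrep] at hu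
  obtain ⟨P, hP⟩ := Finsupp.ne_iff.mp hu
  have hnn := hE.nonneg P
  simp only [Finsupp.coe_zero, Pi.zero_apply] at hP hnn
  have hle : Finsupp.single P 1 ≤ E := by
    intro Q
    by_cases hQ : Q = P
    · rw [hQ, Finsupp.single_eq_same]; omega
    · rw [Finsupp.single_eq_of_ne hQ]; exact hE.nonneg Q
  -- Split off a factor with divisor a prime `P` in the support of `E`; it is no unit, so the
  -- cofactor must be one and `E = P`.
  obtain ⟨b, hb⟩ := 𝓕.exists_hasDivisor hrep (E := Finsupp.single P 1)
    (by simp)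
  obtain ⟨c, hc, rfl⟩ := hb.exists_mul_eq hE hle
  refine ⟨P, ?_⟩
  rcases hirr b c hb.isHomogeneousElem hc.isHomogeneousElem rfl with h | h
  · rw [hb.isUnit_iff hrep] at h
    simp at h
  · rw [hc.isUnit_iff hrep] at h
    rwa [sub_eq_zero.mp h] at hE

/-- The case `m = 0` is excluded because divisor 0 only makes `a` a unit, not the empty product 1.
The induction therefore bottoms out at one prime divisor, where `a` itself is the factor and absorbs
the unit. -/
theorem exists_multiset_prod_eq (m : Multiset V.PrimeDivisor) (hm : m ≠ 0) {a : 𝓕.CoxRing}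
    (ha : 𝓕.HasDivisor a (m.map fun P => Finsupp.single P (1 : ℤ)).sum) :
    ∃ s : Multiset 𝓕.CoxRing, (∀ p ∈ s, IsHIrreducible 𝓕.grading p) ∧ s.prod = a := by
  induction m using Multiset.induction generalizing a with
  | empty => exact absurd rfl hm
  | cons P m ih =>
    rw [Multiset.map_cons, Multiset.sum_cons] at ha
    by_cases hm' : m = 0
    · rw [hm', Multiset.map_zero, Multiset.sum_zero, add_zero] at ha
      refine ⟨{a}, fun p hp => ?_, Multiset.prod_singleton a⟩
      rw [Multiset.mem_singleton.mp hp]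
      exact 𝓕.isHIrreducible_of_hasDivisor_single hrep ha
    · obtain ⟨p, hp⟩ := 𝓕.exists_hasDivisor hrep (E := Finsupp.single P 1) (by simp)
      obtain ⟨b, hb, rfl⟩ := hp.exists_mul_eq ha (le_add_of_nonneg_right
        (Multiset.sum_nonneg fun E hE => by
          obtain ⟨Q, -, rfl⟩ := Multiset.mem_map.mp hE
          simp))
      rw [add_sub_cancel_left] at hb
      obtain ⟨s, hs, rfl⟩ := ih hm' hb
      refine ⟨p ::ₘ s, fun q hq => ?_, Multiset.prod_cons p s⟩
      rcases Multiset.mem_cons.mp hq with rfl | hq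
      · exact 𝓕.isHIrreducible_of_hasDivisor_single hrep hp
      · exact hs q hq

theorem divisor_eq_of_hasDivisor {a : 𝓕.CoxRing} {E : V.WDiv} (h : 𝓕.HasDivisor a E) :
    𝓕.divisor a = E := by
  have h' : ∃ E, 𝓕.HasDivisor a E := ⟨E, h⟩
  rw [divisor, dif_pos h']
  exact h'.choose_spec.unique hrep h

theorem exists_map_divisor_eq {s : Multiset 𝓕.CoxRing}
    (hs : ∀ p ∈ s, IsHIrreducible 𝓕.grading p) :
    ∃ m : Multiset V.PrimeDivisor, s.map 𝓕.divisor = m.map (fun P => Finsupp.single P (1 : ℤ)) ∧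
      𝓕.HasDivisor s.prod (m.map fun P => Finsupp.single P (1 : ℤ)).sum := by
  induction s using Multiset.induction with
  | empty => exact ⟨0, rfl, HasDivisor.one⟩
  | cons p s ih =>
    obtain ⟨m, hm, hd⟩ := ih fun q hq => hs q (Multiset.mem_cons_of_mem hq)
    obtain ⟨P, hP⟩ := 𝓕.exists_hasDivisor_single_of_isHIrreducible hrep
      (hs p (Multiset.mem_cons_self p s))
    refine ⟨P ::ₘ m, ?_, ?_⟩
    · rw [Multiset.map_cons, Multiset.map_cons, hm, 𝓕.divisor_eq_of_hasDivisor hrep hP]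
    · rw [Multiset.prod_cons, Multiset.map_cons, Multiset.sum_cons]
      exact hP.mul hd

theorem rel_associated_of_prod_eq {s t : Multiset 𝓕.CoxRing}
    (hs : ∀ p ∈ s, IsHIrreducible 𝓕.grading p) (ht : ∀ p ∈ t, IsHIrreducible 𝓕.grading p)
    (h : s.prod = t.prod) : Multiset.Rel Associated s t := by
  obtain ⟨m, hm, hms⟩ := 𝓕.exists_map_divisor_eq hrep hs
  obtain ⟨n, hn, hnt⟩ := 𝓕.exists_map_divisor_eq hrep ht
  -- The coefficients of the common divisor are the multiplicities of the primes.
  have hmn : m = n := by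
    ext P
    have hP := DFunLike.congr_fun (hms.unique hrep (h ▸ hnt)) P
    rwa [sum_map_single_apply, sum_map_single_apply, Nat.cast_inj] at hP
  have hst : s.map 𝓕.divisor = t.map 𝓕.divisor := by rw [hm, hn, hmn]
  -- Equality of the multisets of divisors becomes a pairing of the factors of `s` and `t` with
  -- equal divisors, which are then associated.
  rw [← Multiset.rel_eq, Multiset.rel_map] at hst
  refine hst.mono fun a ha b hb hab => ?_
  obtain ⟨P, hP⟩ := 𝓕.exists_hasDivisor_single_of_isHIrreducible hrep (hs a ha)
  obtain ⟨Q, hQ⟩ := 𝓕.exists_hasDivisor_single_of_isHIrreducible hrep (ht b hb)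
  rw [hP.associated_iff hrep hQ, ← 𝓕.divisor_eq_of_hasDivisor hrep hP, ← 𝓕.divisor_eq_of_hasDivisor hrep hQ, hab]

theorem isFactoriallyGraded_grading : IsFactoriallyGraded 𝓕.grading := by
  intro a ha h0 hu
  refine ⟨?_, fun s t hs ht hsa hta => 𝓕.rel_associated_of_prod_eq hrep hs ht (hsa.trans hta.symm)⟩
  obtain ⟨E, hE⟩ := 𝓕.exists_hasDivisor_of_isHomogeneousElem hrep ha h0
  obtain ⟨m, rfl⟩ := exists_multiset_sum_eq hE.nonneg
  refine 𝓕.exists_multiset_prod_eq hrep m ?_ hE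
  rintro rfl
  exact hu hE.isUnit

theorem hasDivisor_divisor (a : NonzeroHomogeneous 𝓕.grading) :
    𝓕.HasDivisor a.1 (𝓕.divisor a.1) := by
  obtain ⟨E, hE⟩ := 𝓕.exists_hasDivisor_of_isHomogeneousElem hrep a.2.1 a.2.2
  rwa [𝓕.divisor_eq_of_hasDivisor hrep hE]

/-- Association classes of non-zero homogeneous elements correspond to effective divisors. -/
def associationClassEquiv : AssociationClass 𝓕.grading ≃ {E : V.WDiv // 0 ≤ E} :=
  Equiv.ofBijective
    (Quotient.lift (fun a => ⟨𝓕.divisor a.1, (𝓕.hasDivisor_divisor hrep a).nonneg⟩) fun a b hab =>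
      Subtype.ext (((𝓕.hasDivisor_divisor hrep a).associated_iff hrep
        (𝓕.hasDivisor_divisor hrep b)).mp hab))
    (by
      constructor
      · intro x y h
        induction x using Quotient.inductionOn with | _ a
        induction y using Quotient.inductionOn with | _ b
        exact Quotient.sound (((𝓕.hasDivisor_divisor hrep a).associated_iff hrep
          (𝓕.hasDivisor_divisor hrep b)).mpr (congrArg Subtype.val h))
      · rintro ⟨E, hE⟩
        obtain ⟨a, ha⟩ := 𝓕.exists_hasDivisor hrep hE
        exact ⟨Quotient.mk _ ⟨a, ha.isHomogeneousElem, ha.ne_zero hrep⟩,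
          Subtype.ext (𝓕.divisor_eq_of_hasDivisor hrep ha)⟩)

end Factoriality

end CoherentFamily

end

end NormalVariety

theorem mainTheorem4 {k : Type u} [Field k] [IsAlgClosed k] (V : NormalVariety k)
    (hCl : AddGroup.FG V.Cl)
    (S : AddSubgroup V.WDiv) (hS : S.FG)
    (hsurj : ∀ c : V.Cl, ∃ D ∈ S, V.toCl D = c)
    (𝓕 : V.CoherentFamily S) :
    Nonempty (GradedAlgebra 𝓕.grading) ∧
    IsFactoriallyGraded 𝓕.grading ∧
    ∃ Φ : AssociationClass 𝓕.grading ≃ {E : V.WDiv // 0 ≤ E},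
      ∀ (D : S) (f : V.sections (D : V.WDiv)), f ≠ 0 →
        ∃ h : SetLike.IsHomogeneousElem 𝓕.grading (𝓕.cls D f) ∧ 𝓕.cls D f ≠ 0,
          (Φ (Quotient.mk _ ⟨𝓕.cls D f, h⟩) : V.WDiv) =
            V.div (f : V.RatFun) + (D : V.WDiv) := by
  -- Surjectivity of `S → Cl(X)` enters through these representatives; neither the grading nor the
  -- divisor of an element depends on the choice.
  choose rep hrepS hrep using hsurj
  let rep' : V.Cl → S := fun c => ⟨rep c, hrepS c⟩
  have hrep' : ∀ c, V.toCl (rep' c : V.WDiv) = c := hrep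
  refine ⟨⟨𝓕.gradedAlgebra hrep'⟩, 𝓕.isFactoriallyGraded_grading hrep',
    𝓕.associationClassEquiv hrep', fun D f hf => ?_⟩
  have h := NormalVariety.CoherentFamily.HasDivisor.of_cls (𝓕 := 𝓕) hf
  exact ⟨⟨h.isHomogeneousElem, h.ne_zero hrep'⟩, 𝓕.divisor_eq_of_hasDivisor hrep' h⟩
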